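/- Let $R>0$ and let $V,U:\mathbb R^3\to\mathbb R$ be measurable with $V\ge 0$ and $U>0$ almost everywhere and $V(x)=0$ for almost every $|x|>R$. Assume that (multiplication by) $U$ is infinitesimally bounded with respect to $-\Delta$ on $L^2(\mathbb R^3)$: $H^2(\mathbb R^3)\subseteq D(U)$, and for every $a>0$ there is $b\in\mathbb R$ with $\|U\varphi\|\le a\|\Delta\varphi\|+b\|\varphi\|$ for all $\varphi\in H^2(\mathbb R^3)$. Let $H=-\Delta-V+U$, as an operator sum in $L^2(\mathbb R^3)$ (with $D(-\Delta)=H^2(\mathbb R^3)$ and each potential on its maximal domain), and suppose that $\psi\in D(H)$ satisfies $\|\psi\|=1$ and $H\psi=0$. Then: 1. For every $F\in C^1(\mathbb R^3)$, real-valued, with $|\nabla F(x)|^2<U(x)$ for almost every $|x|>R$, $$e^{F+\frac12\ln\left(U-|\nabla F|^2\right)}\,\psi\in L^2(\mathbb R^3),$$ where inside the ball $|x|\le R$, where $U-|\nabla F|^2$ need not be positive, $\ln t$ is read as $\ln|t|$ for $t<0$ and as $0$ for $t=0$. 2. In particular, if $C>0$ and $U(x)=C/|x|$ for almost every $|x|>R$,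 then $e^{K\sqrt{|x|}}\,\psi\in L^2(\mathbb R^3)$ for every $K<2\sqrt C$. -/

import Mathlib

open MeasureTheory TemperedDistribution
open scoped SchwartzMap Laplacian Gradient ENNReal

/-- Three-dimensional Euclidean space. -/
abbrev R3 : Type := EuclideanSpace ℝ (Fin 3)

/-- The complex Hilbert space of square-integrable functions on three-space. -/
abbrev L2R3 : Type := Lp ℂ 2 (volume : Measure R3)

/-- The second-order Sobolev space `H²`, as a subspace of `L²`. -/
def sobolevH2 : Submodule ℂ L2R3 where
  carrier := {f | MemSobolev 2 2 (f : 𝓢'(R3, ℂ))}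
  add_mem' {f g} hf hg := by
    have h := MemSobolev.add hf hg
    have e : ((f + g : L2R3) : 𝓢'(R3, ℂ)) = (f : 𝓢'(R3, ℂ)) + (g : 𝓢'(R3, ℂ)) :=
      map_add (Lp.toTemperedDistributionCLM ℂ (volume : Measure R3) 2) f g
    simpa only [Set.mem_ofPred_eq, e] using h
  zero_mem' := by
    have e : ((0 : L2R3) : 𝓢'(R3, ℂ)) = 0 :=
      map_zero (Lp.toTemperedDistributionCLM ℂ (volume : Measure R3) 2)
    simpa only [Set.mem_ofPred_eq, e] using memSobolev_fun_zero R3 ℂ 2 2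
  smul_mem' c f hf := by
    have h := MemSobolev.smul c hf
    have e : ((c • f : L2R3) : 𝓢'(R3, ℂ)) = c • (f : 𝓢'(R3, ℂ)) :=
      map_smul (Lp.toTemperedDistributionCLM ℂ (volume : Measure R3) 2) c f
    simpa only [Set.mem_ofPred_eq, e] using h

theorem toTemperedDistribution_injective_L2R3 :
    Function.Injective (Lp.toTemperedDistributionCLM ℂ (volume : Measure R3) 2) :=
  LinearMap.ker_eq_bot.mp (Lp.ker_toTemperedDistributionCLM_eq_bot (F := ℂ) (p := 2))

/-- For `f` in `H²` the distributional Laplacian is an `L²` function. -/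
theorem exists_neg_laplacian_eq (f : sobolevH2) :
    ∃ g : L2R3, (g : 𝓢'(R3, ℂ)) = -Δ ((f : L2R3) : 𝓢'(R3, ℂ)) := by
  have h : MemSobolev 2 2 ((f : L2R3) : 𝓢'(R3, ℂ)) := f.2
  have h' : MemSobolev 0 2 (Δ ((f : L2R3) : 𝓢'(R3, ℂ))) := by
    simpa using h.laplacian
  obtain ⟨g, hg⟩ := memSobolev_zero_iff.mp h'.neg
  exact ⟨g, hg.symm⟩

/-- The operator `-Δ` on `L²`, with domain `H²`: the distributional Laplacian. -/
noncomputable def negLaplacian : L2R3 →ₗ.[ℂ] L2R3 where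
  domain := sobolevH2
  toFun :=
    { toFun := fun f => (exists_neg_laplacian_eq f).choose
      map_add' := fun f g => by
        apply toTemperedDistribution_injective_L2R3
        rw [map_add]
        simp only [Lp.toTemperedDistributionCLM_apply]
        rw [(exists_neg_laplacian_eq (f + g)).choose_spec,
          (exists_neg_laplacian_eq f).choose_spec, (exists_neg_laplacian_eq g).choose_spec,
          ← neg_add, Submodule.coe_add, ← Lp.toTemperedDistributionCLM_apply, map_add]
        simp only [Lp.toTemperedDistributionCLM_apply]
        rw [← laplacianCLM_apply, map_add]
        simp only [laplacianCLM_apply]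
      map_smul' := fun c f => by
        apply toTemperedDistribution_injective_L2R3
        rw [RingHom.id_apply, map_smul]
        simp only [Lp.toTemperedDistributionCLM_apply]
        rw [(exists_neg_laplacian_eq (c • f)).choose_spec,
          (exists_neg_laplacian_eq f).choose_spec,
          smul_neg, Submodule.coe_smul, ← Lp.toTemperedDistributionCLM_apply, map_smul]
        simp only [Lp.toTemperedDistributionCLM_apply]
        rw [← laplacianCLM_apply, map_smul]
        simp only [laplacianCLM_apply] }

theorem negLaplacian_spec (f : negLaplacian.domain) :
    ((negLaplacian f : L2R3) : 𝓢'(R3, ℂ)) = -Δ ((f : L2R3) : 𝓢'(R3, ℂ)) :=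
  (exists_neg_laplacian_eq f).choose_spec

/-- The functions `f` in `L²` for which `W f` is again in `L²`. -/
def mulDomain (W : R3 → ℝ) : Submodule ℂ L2R3 where
  carrier := {f | MemLp (fun x => (W x : ℂ) * f x) 2 volume}
  add_mem' {f g} hf hg := by
    refine (MemLp.add hf hg).ae_eq ?_
    filter_upwards [Lp.coeFn_add f g] with x hx
    rw [hx]
    simp [mul_add]
  zero_mem' := by
    refine (MemLp.zero (ε := ℂ)).ae_eq ?_
    filter_upwards [Lp.coeFn_zero ℂ 2 (volume : Measure R3)] with x hx
    rw [hx]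
    simp
  smul_mem' c f hf := by
    refine (MemLp.const_smul hf c).ae_eq ?_
    filter_upwards [Lp.coeFn_smul c f] with x hx
    rw [hx]
    simp only [Pi.smul_apply, smul_eq_mul]
    ring

theorem mem_mulDomain {W : R3 → ℝ} {f : L2R3} (hf : f ∈ mulDomain W) :
    MemLp (fun x => (W x : ℂ) * f x) 2 volume := hf

/-- Multiplication by the real function `W`, on its maximal domain in `L²`. -/
noncomputable def mulOp (W : R3 → ℝ) : L2R3 →ₗ.[ℂ] L2R3 where
  domain := mulDomain W
  toFun :=
    { toFun := fun f => (mem_mulDomain f.2).toLp (fun x => (W x : ℂ) * (f : L2R3) x)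
      map_add' := fun f g => by
        rw [← MemLp.toLp_add, MemLp.toLp_eq_toLp_iff]
        filter_upwards [Lp.coeFn_add (f : L2R3) (g : L2R3)] with x hx
        rw [Submodule.coe_add, hx]
        simp [mul_add]
      map_smul' := fun c f => by
        rw [RingHom.id_apply, ← MemLp.toLp_const_smul, MemLp.toLp_eq_toLp_iff]
        filter_upwards [Lp.coeFn_smul c (f : L2R3)] with x hx
        rw [Submodule.coe_smul, hx]
        simp only [Pi.smul_apply, smul_eq_mul]
        ring }

/-- `B` is infinitesimally bounded with respect to `A` (relative bound zero in operator sense). -/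
def InfinitesimallyBounded (B A : L2R3 →ₗ.[ℂ] L2R3) : Prop :=
  ∃ h : A.domain ≤ B.domain, ∀ a : ℝ, 0 < a → ∃ b : ℝ, ∀ f : A.domain,
    ‖B ⟨(f : L2R3), h f.2⟩‖ ≤ a * ‖A f‖ + b * ‖(f : L2R3)‖

/-- The Hamiltonian `-Δ - V + U`, an operator sum: its domain is the intersection of the three
domains. -/
noncomputable def hamiltonian (V U : R3 → ℝ) : L2R3 →ₗ.[ℂ] L2R3 :=
  negLaplacian - mulOp V + mulOp U

/-!
Agmon's exponential decay method, for an operator with no ellipticity gap at infinity.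

Localized energy inequality. For `u ∈ H²` and a real `C¹` function `g` of compact support,
`Re ⟪g² u, -Δ u⟫ + ∫ |∇g|² |u|² ≥ 0`, because for smooth `u` an integration by parts turns the
left-hand side into `∑ᵢ ∫ |g ∂ᵢu + (∂ᵢg) u|²`. Both terms are continuous in the pair `(u, -Δ u)` of
`L²` functions, so the inequality passes from Schwartz functions to all of `H²`. The approximating
sequence is obtained by applying the Bessel potential `J₋₂`, a contraction of `L²`, to Schwartz
functions that converge to `J₂ u`; the Laplacians converge as well since `-Δ = (2π)² (J₂ - 1)`.
For a zero-energy state `-Δψ = (V - U)ψ`, so that the density `w = |ψ|²` satisfies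
`0 ≤ ∫ g² (V - U) w + ∫ |∇g|² w` for all such `g` (`hamiltonian_energy_nonneg`).

Removing the cutoff. With `g = χ(·/n) e^F` and `F` bounded above, the terms that contain `∇χ` are
at most a constant times `n⁻¹ ∫ (1 + |∇F|²) w`, which is finite because `|∇F|² ≤ U` outside a
compact set and `∫ U w < ∞`. Letting `n → ∞`,
`∫ e^{2F} (U - |∇F|²) w ≤ ∫ e^{2F} V w` (`integral_exp_sq_mul_nonneg_of_bddAbove`).

Unbounded phases. A general `F` is replaced by `F_ε = -log (e^{-F} + ε)`, which is bounded above,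
lies below `F`, has `|∇F_ε| ≤ |∇F|`, and increases to `F` as `ε → 0`. Since `V` vanishes off a ball,
the part of the integral outside that ball is bounded by an integral over the ball not depending on
`ε`, and Fatou's lemma gives the weighted bound for `F` (`integrableOn_exp_sq_mul`). No positive
lower bound on `U - |∇F|²` is needed.

The Coulomb-type tail `U = C / |x|` is the case `F = K' (1 + |x|²)^{1/4}` with `K < K' < 2 √C`: then
`U - |∇F|² ≥ (C - K'² / 4) / |x|`, and the loss of the factor `|x|^{-1/2}` is absorbed by
`e^{(K' - K) √|x|}`.
-/

/-! ### The localized energy inequality for Schwartz functions -/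

section Schwartz

variable {E : Type*} [NormedAddCommGroup E] [InnerProductSpace ℝ E] [FiniteDimensional ℝ E]
  [MeasurableSpace E] [BorelSpace E]

open scoped LineDeriv

theorem HasCompactSupport.integrable_of_eq_zero {f g : E → ℝ} (hg : HasCompactSupport g)
    (hf : Continuous f) (h : ∀ x, g x = 0 → f x = 0) : Integrable f :=
  hf.integrable_of_hasCompactSupport <| hg.mono fun x hx => by
    contrapose! hx
    simpa using h x (by simpa using hx)

/-- The localized energy inequality for a single direction `v`: after an integration by parts the
left-hand side is the integral of `‖g ∂ᵥu + (∂ᵥg) u‖²`. -/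
theorem integral_localized_lineDeriv_nonneg (u : 𝓢(E, ℂ)) {g : E → ℝ} (hg : ContDiff ℝ 1 g)
    (hgs : HasCompactSupport g) (v : E) :
    0 ≤ (∫ x, inner ℝ ((g x) ^ 2 • u x) (-(∂_{v} (∂_{v} u)) x)) +
      ∫ x, (fderiv ℝ g x v) ^ 2 * ‖u x‖ ^ 2 := by
  have hgc : Continuous g := hg.continuous
  have hgc' : Continuous fun x => fderiv ℝ g x v :=
    (hg.continuous_fderiv one_ne_zero).clm_apply continuous_const
  have hgs' : HasCompactSupport fun x => fderiv ℝ g x v := hgs.fderiv_apply ℝ v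
  have hu : Continuous u := u.continuous
  have hu1 : Continuous (∂_{v} u : 𝓢(E, ℂ)) := (∂_{v} u).continuous
  have hu2 : Continuous (∂_{v} (∂_{v} u) : 𝓢(E, ℂ)) := (∂_{v} (∂_{v} u)).continuous
  have hder : ∀ x, HasFDerivAt (fun x => (g x) ^ 2 • u x)
      ((g x) ^ 2 • fderiv ℝ u x +
        ((2 * g x) • fderiv ℝ g x).smulRight (u x)) x := by
    intro x
    have h1 : HasFDerivAt (fun x => (g x) ^ 2) ((2 * g x) • fderiv ℝ g x) x := by
      simpa using ((hg.differentiable one_ne_zero) x).hasFDerivAt.pow 2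
    exact h1.smul (u.hasFDerivAt x)
  have hval : ∀ x, ((g x) ^ 2 • fderiv ℝ u x +
        ((2 * g x) • fderiv ℝ g x).smulRight (u x)) v =
        (g x) ^ 2 • (∂_{v} u) x + (2 * g x * fderiv ℝ g x v) • u x := by
    intro x
    simp [SchwartzMap.lineDerivOp_apply_eq_fderiv]
  -- `innerSL` enters through its values only: its type mentions the normed space structure that
  -- comes from the real inner product on `ℂ`, which is not syntactically the one used above.
  obtain ⟨B, hB⟩ : ∃ B : ℂ →L[ℝ] ℂ →L[ℝ] ℝ, ∀ a b, B a b = inner ℝ a b :=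
    ⟨innerSL ℝ, fun _ _ => rfl⟩
  have key := integral_bilinear_hasFDerivAt_right_eq_neg_left_of_integrable (μ := volume)
    (f := fun x => (g x) ^ 2 • u x)
    (f' := fun x => (g x) ^ 2 • fderiv ℝ u x +
        ((2 * g x) • fderiv ℝ g x).smulRight (u x))
    (g := (∂_{v} u : 𝓢(E, ℂ)))
    (g' := fun x => fderiv ℝ (∂_{v} u : 𝓢(E, ℂ)) x) (v := v) (B := B)
    ?_ ?_ ?_ (fun x _ => hder x) (fun x _ => (∂_{v} u : 𝓢(E, ℂ)).hasFDerivAt x)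
  · simp only [hB, hval, ← SchwartzMap.lineDerivOp_apply_eq_fderiv] at key
    simp only [inner_neg_right, integral_neg]
    rw [key, neg_neg, ← integral_add]
    · refine integral_nonneg fun x => ?_
      have : (0 : ℝ) ≤ ‖g x • (∂_{v} u) x + fderiv ℝ g x v • u x‖ ^ 2 := by positivity
      rw [norm_add_sq_real] at this
      simp only [norm_smul, mul_pow, real_inner_smul_left, real_inner_smul_right,
        Real.norm_eq_abs, sq_abs] at this
      simp only [Pi.zero_apply, inner_add_left, real_inner_smul_left, real_inner_self_eq_norm_sq]
      rw [real_inner_comm] at this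
      linarith
    · exact hgs.integrable_of_eq_zero (by fun_prop) fun x hx => by simp [hx]
    · exact hgs'.integrable_of_eq_zero (by fun_prop) fun x hx => by simp [hx]
  · simp only [hB, hval]
    exact hgs.integrable_of_eq_zero (by fun_prop) fun x hx => by simp [hx]
  · simp only [hB, ← SchwartzMap.lineDerivOp_apply_eq_fderiv]
    exact hgs.integrable_of_eq_zero (by fun_prop) fun x hx => by simp [hx]
  · simp only [hB]
    exact hgs.integrable_of_eq_zero (by fun_prop) fun x hx => by simp [hx]

/-- The localized energy inequality for Schwartz functions, by summing over an orthonormal basis. -/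
theorem SchwartzMap.localized_energy_nonneg (u : 𝓢(E, ℂ)) {g : E → ℝ} (hg : ContDiff ℝ 1 g)
    (hgs : HasCompactSupport g) :
    0 ≤ (∫ x, inner ℝ ((g x) ^ 2 • u x) (-(Δ u) x)) + ∫ x, ‖fderiv ℝ g x‖ ^ 2 * ‖u x‖ ^ 2 := by
  let b := stdOrthonormalBasis ℝ E
  have hnorm : ∀ x, ‖fderiv ℝ g x‖ ^ 2 = ∑ i, (fderiv ℝ g x (b i)) ^ 2 := by
    intro x
    have h := b.sum_sq_inner_left ((InnerProductSpace.toDual ℝ E).symm (fderiv ℝ g x))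
    simpa using h.symm
  have hint : ∀ i, Integrable fun x =>
      inner ℝ ((g x) ^ 2 • u x) (-(∂_{b i} (∂_{b i} u)) x) := by
    intro i
    have hgc : Continuous g := hg.continuous
    have hu : Continuous u := u.continuous
    have hu2 : Continuous (∂_{b i} (∂_{b i} u) : 𝓢(E, ℂ)) := (∂_{b i} (∂_{b i} u)).continuous
    exact hgs.integrable_of_eq_zero (by fun_prop) fun x hx => by simp [hx]
  have hint' : ∀ i, Integrable fun x => (fderiv ℝ g x (b i)) ^ 2 * ‖u x‖ ^ 2 := by
    intro i
    have hgc' : Continuous fun x => fderiv ℝ g x (b i) :=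
      (hg.continuous_fderiv one_ne_zero).clm_apply continuous_const
    have hu : Continuous u := u.continuous
    exact (hgs.fderiv_apply ℝ (b i)).integrable_of_eq_zero (by fun_prop) fun x hx => by simp [hx]
  have h1 : (∫ x, inner ℝ ((g x) ^ 2 • u x) (-(Δ u) x)) =
      ∑ i, ∫ x, inner ℝ ((g x) ^ 2 • u x) (-(∂_{b i} (∂_{b i} u)) x) := by
    rw [← integral_finsetSum _ fun i _ => hint i]
    refine integral_congr_ae (.of_forall fun x => ?_)
    simp only [SchwartzMap.laplacian_eq_sum b, _root_.sum_apply, inner_neg_right,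
      inner_sum, Finset.sum_neg_distrib]
  have h2 : (∫ x, ‖fderiv ℝ g x‖ ^ 2 * ‖u x‖ ^ 2) =
      ∑ i, ∫ x, (fderiv ℝ g x (b i)) ^ 2 * ‖u x‖ ^ 2 := by
    rw [← integral_finsetSum _ fun i _ => hint' i]
    refine integral_congr_ae (.of_forall fun x => ?_)
    simp only [hnorm, Finset.sum_mul]
  rw [h1, h2, ← Finset.sum_add_distrib]
  exact Finset.sum_nonneg fun i _ => integral_localized_lineDeriv_nonneg u hg hgs (b i)

end Schwartz

/-! ### Schwartz approximation in `H²` -/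

section Density

variable {E : Type*} [NormedAddCommGroup E] [InnerProductSpace ℝ E] [FiniteDimensional ℝ E]
  [MeasurableSpace E] [BorelSpace E]

open FourierTransform Filter Topology

theorem Lp.toTemperedDistribution_injective :
    Function.Injective (Lp.toTemperedDistributionCLM ℂ (volume : Measure E) 2) :=
  LinearMap.ker_eq_bot.mp (Lp.ker_toTemperedDistributionCLM_eq_bot (F := ℂ) (p := 2))

/-- The Bessel potential of order `-2` is a contraction of `L²`, by Plancherel: its symbol
`(1 + ‖x‖²)⁻¹` is bounded by one. -/
theorem Lp.norm_le_of_besselPotential_neg_two_eq {u v : Lp ℂ 2 (volume : Measure E)}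
    (h : besselPotential E ℂ (-2) (u : 𝓢'(E, ℂ)) = v) : ‖v‖ ≤ ‖u‖ := by
  have hm : ∀ x : E, ‖(((1 + ‖x‖ ^ 2) ^ ((-2 : ℝ) / 2) : ℝ) : ℂ)‖ ≤ 1 := by
    intro x
    rw [Complex.norm_real, Real.norm_of_nonneg (by positivity)]
    exact Real.rpow_le_one_of_one_le_of_nonpos (by simp) (by norm_num)
  have hmg : Function.HasTemperateGrowth
      fun x : E => (((1 + ‖x‖ ^ 2) ^ ((-2 : ℝ) / 2) : ℝ) : ℂ) := by fun_prop
  have hml : MemLp (fun x : E => (((1 + ‖x‖ ^ 2) ^ ((-2 : ℝ) / 2) : ℝ) : ℂ)) ∞ volume :=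
    memLp_top_of_bound hmg.1.continuous.aestronglyMeasurable 1 (.of_forall hm)
  have h1 : (hml.toLp _) • (𝓕 u) = 𝓕 v := by
    apply Lp.toTemperedDistribution_injective
    simp only [Lp.toTemperedDistributionCLM_apply]
    rw [Lp.toTemperedDistribution_smul_eq hmg, ← Lp.fourier_toTemperedDistribution_eq,
      ← Lp.fourier_toTemperedDistribution_eq, ← h,
      fourier_besselPotential_eq_smulLeftCLM_fourier_apply]
  rw [← Lp.norm_fourier_eq v, ← Lp.norm_fourier_eq u, ← h1]
  refine (Lp.norm_smul_le _ _).trans ?_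
  have h2 : ‖hml.toLp _‖ ≤ 1 := by
    rw [Lp.norm_toLp]
    refine ENNReal.toReal_le_of_le_ofReal zero_le_one ?_
    rw [eLpNorm_exponent_top]
    exact eLpNormEssSup_le_of_ae_bound (.of_forall hm)
  exact mul_le_of_le_one_left (norm_nonneg _) h2

/-- The factor `(2π)²` comes from the normalization of the Fourier transform: the symbol of `-Δ` is
`(2π)² ‖x‖²`, that of the Bessel potential of order `2` is `1 + ‖x‖²`. -/
theorem neg_laplacian_eq_besselPotential (f : 𝓢'(E, ℂ)) :
    -Δ f = (2 * Real.pi) ^ 2 • (besselPotential E ℂ 2 f - f) := by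
  have h : besselPotential E ℂ 2 f =
      f + fourierMultiplierCLM ℂ (fun x : E => Complex.ofReal (‖x‖ ^ 2)) f := by
    have e : (fun x : E => (((1 + ‖x‖ ^ 2) ^ ((2 : ℝ) / 2) : ℝ) : ℂ)) =
        (fun _ => (1 : ℂ)) + fun x : E => Complex.ofReal (‖x‖ ^ 2) := by
      ext x
      simp
    rw [besselPotential, e, fourierMultiplierCLM_apply,
      smulLeftCLM_add (by fun_prop) (by fun_prop), _root_.add_apply,
      FourierTransform.fourierInv_add, ← fourierMultiplierCLM_apply, ← fourierMultiplierCLM_apply]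
    simp
  rw [h, laplacian_eq_fourierMultiplierCLM]
  simp

/-- Schwartz functions are dense in `H²` for the graph norm of the Laplacian. -/
theorem exists_schwartz_tendsto_of_memSobolev_two {f h : Lp ℂ 2 (volume : Measure E)}
    (hf : MemSobolev 2 2 (f : 𝓢'(E, ℂ))) (hh : (h : 𝓢'(E, ℂ)) = -Δ (f : 𝓢'(E, ℂ))) :
    ∃ φ : ℕ → 𝓢(E, ℂ), Tendsto (fun n => (φ n).toLp 2) atTop (𝓝 f) ∧
      Tendsto (fun n => (-Δ (φ n)).toLp 2) atTop (𝓝 h) := by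
  obtain ⟨u, hu⟩ := hf
  obtain ⟨w, hw⟩ : ∃ w : ℕ → 𝓢(E, ℂ), Tendsto (fun n => (w n).toLp 2) atTop (𝓝 u) := by
    have hd : DenseRange (SchwartzMap.toLpCLM ℝ ℂ 2 (volume : Measure E)) :=
      SchwartzMap.denseRange_toLpCLM (by simp)
    obtain ⟨x, hx, hxu⟩ := mem_closure_iff_seq_limit.mp (hd u)
    choose w hw using hx
    rw [← funext hw] at hxu
    exact ⟨w, hxu⟩
  have hmg : Function.HasTemperateGrowth
      fun x : E => (((1 + ‖x‖ ^ 2) ^ ((-2 : ℝ) / 2) : ℝ) : ℂ) := by fun_prop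
  set φ : ℕ → 𝓢(E, ℂ) := fun n => SchwartzMap.fourierMultiplierCLM ℂ
    (fun x : E => (((1 + ‖x‖ ^ 2) ^ ((-2 : ℝ) / 2) : ℝ) : ℂ)) (w n) with hφ
  have hφw : ∀ n, besselPotential E ℂ (-2) (((w n).toLp 2 : Lp ℂ 2 (volume : Measure E)) :
      𝓢'(E, ℂ)) = (((φ n).toLp 2 : Lp ℂ 2 (volume : Measure E)) : 𝓢'(E, ℂ)) := by
    intro n
    rw [besselPotential, Lp.toTemperedDistribution_toLp_eq, Lp.toTemperedDistribution_toLp_eq,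
      fourierMultiplierCLM_toTemperedDistributionCLM_eq hmg]
  have huf : besselPotential E ℂ (-2) (u : 𝓢'(E, ℂ)) = f :=
    (besselPotential_neg_apply_eq_iff 2 _ _).mpr hu
  have hφf : Tendsto (fun n => (φ n).toLp 2) atTop (𝓝 f) := by
    rw [tendsto_iff_norm_sub_tendsto_zero] at hw ⊢
    refine squeeze_zero (fun n => norm_nonneg _) (fun n => ?_) hw
    apply Lp.norm_le_of_besselPotential_neg_two_eq
    simp only [← Lp.toTemperedDistributionCLM_apply, map_sub] at hφw huf ⊢
    rw [hφw, huf]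
  -- `-Δ = (2π)² (J₂ - 1)`, read in `L²`; it applies to the limit and to each approximant.
  have key : ∀ a b c : Lp ℂ 2 (volume : Measure E), (a : 𝓢'(E, ℂ)) = -Δ (b : 𝓢'(E, ℂ)) →
      besselPotential E ℂ 2 (b : 𝓢'(E, ℂ)) = c → a = (2 * Real.pi) ^ 2 • (c - b) := by
    intro a b c hab hbc
    apply Lp.toTemperedDistribution_injective
    rw [neg_laplacian_eq_besselPotential, hbc] at hab
    rw [ContinuousLinearMap.map_smul_of_tower, map_sub]
    exact hab
  refine ⟨φ, hφf, ?_⟩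
  rw [key h f u hh hu]
  have h3 : ∀ n, (-Δ (φ n)).toLp 2 volume =
      (2 * Real.pi) ^ 2 • ((w n).toLp 2 (volume : Measure E) - (φ n).toLp 2 volume) := by
    intro n
    apply key
    · rw [Lp.toTemperedDistribution_toLp_eq, Lp.toTemperedDistribution_toLp_eq,
        laplacian_toTemperedDistributionCLM_eq, map_neg]
    · exact (besselPotential_neg_apply_eq_iff 2 _ _).mp (hφw n)
  simp only [h3]
  exact (hw.sub hφf).const_smul _

theorem Lp.continuous_integral_mul_inner {F : Type*} [NormedAddCommGroup F]
    [InnerProductSpace ℝ F] {c : E → ℝ} (hc : MemLp c ∞ volume) :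
    Continuous fun z : Lp F 2 (volume : Measure E) × Lp F 2 (volume : Measure E) =>
      ∫ x, c x * inner ℝ (z.1 x) (z.2 x) := by
  let T : Lp F 2 (volume : Measure E) →L[ℝ] Lp F 2 (volume : Measure E) :=
    (ContinuousLinearMap.lsmul ℝ ℝ (E := F)).holderL volume ∞ 2 2 (hc.toLp c)
  have hT : ∀ u, T u =ᵐ[volume] fun x => c x • u x := by
    intro u
    filter_upwards [(ContinuousLinearMap.lsmul ℝ ℝ (E := F)).coeFn_holder (r := 2) (hc.toLp c) u,
      hc.coeFn_toLp] with x h1 h2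
    rw [← h2]
    exact h1
  have hcont : Continuous fun z : Lp F 2 (volume : Measure E) × Lp F 2 (volume : Measure E) =>
      inner ℝ (T z.1) z.2 :=
    (T.continuous.comp continuous_fst).inner continuous_snd
  refine hcont.congr fun z => ?_
  rw [L2.inner_def]
  refine integral_congr_ae ?_
  filter_upwards [hT z.1] with x h1
  rw [h1, real_inner_smul_left]

/-- The localized energy inequality on `H²`; `h` represents `-Δ f`. -/
theorem localized_energy_nonneg {f h : Lp ℂ 2 (volume : Measure E)}
    (hf : MemSobolev 2 2 (f : 𝓢'(E, ℂ))) (hh : (h : 𝓢'(E, ℂ)) = -Δ (f : 𝓢'(E, ℂ)))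
    {g : E → ℝ} (hg : ContDiff ℝ 1 g) (hgs : HasCompactSupport g) :
    0 ≤ (∫ x, (g x) ^ 2 * inner ℝ (f x) (h x)) + ∫ x, ‖fderiv ℝ g x‖ ^ 2 * ‖f x‖ ^ 2 := by
  obtain ⟨φ, hφ, hφ'⟩ := exists_schwartz_tendsto_of_memSobolev_two hf hh
  have hgl : MemLp (fun x => (g x) ^ 2) ∞ (volume : Measure E) :=
    (hg.continuous.pow 2).memLp_top_of_hasCompactSupport
      (hgs.mono fun x hx => by contrapose! hx; simp_all) volume
  have hdl : MemLp (fun x => ‖fderiv ℝ g x‖ ^ 2) ∞ (volume : Measure E) :=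
    ((hg.continuous_fderiv one_ne_zero).norm.pow 2).memLp_top_of_hasCompactSupport
      ((hgs.fderiv ℝ).mono fun x hx => by contrapose! hx; simp_all) volume
  have hlim := (((Lp.continuous_integral_mul_inner hgl).tendsto (f, h)).comp
    (hφ.prodMk_nhds hφ')).add (((Lp.continuous_integral_mul_inner hdl).tendsto (f, f)).comp
    (hφ.prodMk_nhds hφ))
  simp only [Function.comp_apply, real_inner_self_eq_norm_sq] at hlim
  refine ge_of_tendsto' hlim fun n => ?_
  have h1 : (∫ x, (g x) ^ 2 * inner ℝ (((φ n).toLp 2 volume) x) (((-Δ (φ n)).toLp 2 volume) x)) =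
      ∫ x, inner ℝ ((g x) ^ 2 • φ n x) (-(Δ (φ n)) x) := by
    refine integral_congr_ae ?_
    filter_upwards [(φ n).coeFn_toLp 2 volume, (-Δ (φ n)).coeFn_toLp 2 volume] with x h1 h2
    rw [h1, h2, real_inner_smul_left, _root_.neg_apply]
  have h2 : (∫ x, ‖fderiv ℝ g x‖ ^ 2 * ‖((φ n).toLp 2 volume) x‖ ^ 2) =
      ∫ x, ‖fderiv ℝ g x‖ ^ 2 * ‖φ n x‖ ^ 2 := by
    refine integral_congr_ae ?_
    filter_upwards [(φ n).coeFn_toLp 2 volume] with x h1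
    rw [h1]
  have h3 := (φ n).localized_energy_nonneg hg hgs
  rw [← h1, ← h2] at h3
  exact h3

end Density

/-! ### The weighted inequality for phases bounded above -/

section Agmon

variable {E : Type*} [NormedAddCommGroup E] [InnerProductSpace ℝ E] [FiniteDimensional ℝ E]
  [MeasurableSpace E] [BorelSpace E]

open Filter Topology

/-- Cutoff functions converging to `1`, the dilates of a fixed bump; their gradients tend to zero
uniformly. -/
theorem exists_contDiff_cutoff (E : Type*) [NormedAddCommGroup E] [InnerProductSpace ℝ E]
    [FiniteDimensional ℝ E] :
    ∃ χ : ℕ → E → ℝ, ∃ δ : ℕ → ℝ, (∀ n, ContDiff ℝ 1 (χ n)) ∧ (∀ n, HasCompactSupport (χ n)) ∧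
      (∀ n x, 0 ≤ χ n x) ∧ (∀ n x, χ n x ≤ 1) ∧ (∀ n x, ‖fderiv ℝ (χ n) x‖ ≤ δ n) ∧
      (∀ x, Tendsto (fun n => χ n x) atTop (𝓝 1)) ∧ Tendsto δ atTop (𝓝 0) := by
  let η : ContDiffBump (0 : E) := ⟨1, 2, one_pos, one_lt_two⟩
  have hη : ContDiff ℝ 1 η := η.contDiff
  obtain ⟨M, hM⟩ := (η.hasCompactSupport.fderiv ℝ).exists_bound_of_continuous
    (hη.continuous_fderiv one_ne_zero)
  have hpos : ∀ n : ℕ, (0 : ℝ) < n + 1 := fun n => by positivity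
  refine ⟨fun n x => η (((n : ℝ) + 1)⁻¹ • x), fun n => ((n : ℝ) + 1)⁻¹ * M, fun n => by fun_prop,
    fun n => ?_, fun n x => η.nonneg, fun n x => η.le_one, fun n x => ?_, fun x => ?_, ?_⟩
  · exact η.hasCompactSupport.comp_smul (inv_ne_zero (hpos n).ne')
  · rw [fderiv_comp_smul, norm_smul, Real.norm_of_nonneg (inv_nonneg.mpr (hpos n).le)]
    exact mul_le_mul_of_nonneg_left (hM _) (inv_nonneg.mpr (hpos n).le)
  · obtain ⟨N, hN⟩ := exists_nat_ge ‖x‖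
    refine tendsto_const_nhds.congr' ?_
    filter_upwards [eventually_ge_atTop N] with n hn
    refine (η.one_of_mem_closedBall ?_).symm
    rw [mem_closedBall_zero_iff, norm_smul, Real.norm_of_nonneg (inv_nonneg.mpr (hpos n).le),
      inv_mul_le_iff₀ (hpos n)]
    have : (N : ℝ) ≤ n := by exact_mod_cast hn
    change ‖x‖ ≤ (n + 1) * 1
    linarith
  · have h := (tendsto_one_div_add_atTop_nhds_zero_nat (𝕜 := ℝ)).mul_const M
    simpa using h

/-- Agmon's inequality for a phase bounded above. Here `w` plays the role of `|ψ|²`, and the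
hypothesis `henergy` is all that is used of the eigenvalue equation. -/
theorem integral_exp_sq_mul_nonneg_of_bddAbove {w V U : E → ℝ} (hw : ∀ x, 0 ≤ w x)
    (hwi : Integrable w) (hVw : Integrable fun x => V x * w x)
    (hUw : Integrable fun x => U x * w x)
    (henergy : ∀ g : E → ℝ, ContDiff ℝ 1 g → HasCompactSupport g →
      0 ≤ (∫ x, (g x) ^ 2 * ((V x - U x) * w x)) + ∫ x, ‖fderiv ℝ g x‖ ^ 2 * w x)
    {F : E → ℝ} (hF : ContDiff ℝ 1 F) {B : ℝ} (hB : ∀ x, F x ≤ B)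
    (hdF : Integrable fun x => ‖fderiv ℝ F x‖ ^ 2 * w x) :
    0 ≤ ∫ x, Real.exp (F x) ^ 2 * ((V x - U x + ‖fderiv ℝ F x‖ ^ 2) * w x) := by
  obtain ⟨χ, δ, hχ, hχs, hχ0, hχ1, hχd, hχlim, hδ⟩ := exists_contDiff_cutoff E
  have hδ0 : ∀ n, 0 ≤ δ n := fun n => (norm_nonneg _).trans (hχd n 0)
  have hk : Integrable fun x => (V x - U x + ‖fderiv ℝ F x‖ ^ 2) * w x :=
    ((hVw.sub hUw).add hdF).congr (.of_forall fun x => by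
      simp only [Pi.add_apply, Pi.sub_apply]; ring)
  have hVU : Integrable fun x => (V x - U x) * w x :=
    (hVw.sub hUw).congr (.of_forall fun x => by simp only [Pi.sub_apply]; ring)
  have hJ : Integrable fun x => (1 + ‖fderiv ℝ F x‖ ^ 2) * w x :=
    (hwi.add hdF).congr (.of_forall fun x => by simp only [Pi.add_apply]; ring)
  have hFc : Continuous F := hF.continuous
  have hexp : ∀ x, Real.exp (F x) ^ 2 ≤ Real.exp B ^ 2 := fun x => by gcongr; exact hB x
  have hbound : ∀ n x, ‖(χ n x * Real.exp (F x)) ^ 2‖ ≤ Real.exp B ^ 2 := by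
    intro n x
    rw [Real.norm_of_nonneg (sq_nonneg _), mul_pow]
    refine (mul_le_of_le_one_left (sq_nonneg _) (pow_le_one₀ (hχ0 n x) (hχ1 n x))).trans (hexp x)
  have hmeas : ∀ n, AEStronglyMeasurable (fun x => (χ n x * Real.exp (F x)) ^ 2) volume := by
    intro n
    have := (hχ n).continuous
    exact Continuous.aestronglyMeasurable (by fun_prop)
  have hint : ∀ n, Integrable fun x =>
      (χ n x * Real.exp (F x)) ^ 2 * ((V x - U x + ‖fderiv ℝ F x‖ ^ 2) * w x) :=
    fun n => hk.bdd_mul (hmeas n) (.of_forall (hbound n))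
  have hn : ∀ n, 0 ≤ (∫ x, (χ n x * Real.exp (F x)) ^ 2 *
      ((V x - U x + ‖fderiv ℝ F x‖ ^ 2) * w x)) +
      (δ n + δ n ^ 2) * (Real.exp B ^ 2 * ∫ x, (1 + ‖fderiv ℝ F x‖ ^ 2) * w x) := by
    intro n
    have hgd : ∀ x, fderiv ℝ (fun x => χ n x * Real.exp (F x)) x =
        Real.exp (F x) • (χ n x • fderiv ℝ F x + fderiv ℝ (χ n) x) := by
      intro x
      have h1 := (((hχ n).differentiable one_ne_zero) x).hasFDerivAt
      have h2 := ((hF.differentiable one_ne_zero) x).hasFDerivAt.exp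
      rw [show (fun x => χ n x * Real.exp (F x)) = χ n * fun x => Real.exp (F x) from rfl,
        (h1.mul h2).fderiv]
      ext v
      simp
      ring
    have hg : ContDiff ℝ 1 fun x => χ n x * Real.exp (F x) := (hχ n).mul hF.exp
    have hgs : HasCompactSupport fun x => χ n x * Real.exp (F x) := (hχs n).mul_right
    refine (henergy _ hg hgs).trans ?_
    have hgi : Integrable fun x => ‖fderiv ℝ (fun x => χ n x * Real.exp (F x)) x‖ ^ 2 * w x := by
      have hc := hg.continuous_fderiv one_ne_zero
      obtain ⟨M, hM⟩ := (hgs.fderiv ℝ).exists_bound_of_continuous hc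
      refine hwi.bdd_mul (c := M ^ 2) (hc.norm.pow 2).aestronglyMeasurable (.of_forall fun x => ?_)
      rw [norm_pow, norm_norm]
      exact pow_le_pow_left₀ (norm_nonneg _) (hM x) 2
    have hVUi := hVU.bdd_mul (hmeas n) (.of_forall (hbound n))
    rw [← integral_const_mul, ← integral_const_mul, ← integral_add (hint n)
      ((hJ.const_mul _).const_mul _), ← integral_add hVUi hgi]
    refine integral_mono (hVUi.add hgi) ((hint n).add ((hJ.const_mul _).const_mul _)) fun x => ?_
    have hgn : ‖fderiv ℝ (fun x => χ n x * Real.exp (F x)) x‖ ≤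
        Real.exp (F x) * (χ n x * ‖fderiv ℝ F x‖ + δ n) := by
      rw [hgd, norm_smul, Real.norm_of_nonneg (Real.exp_pos _).le]
      refine mul_le_mul_of_nonneg_left ((norm_add_le _ _).trans ?_) (Real.exp_pos _).le
      rw [norm_smul, Real.norm_of_nonneg (hχ0 n x)]
      exact add_le_add le_rfl (hχd n x)
    -- Expanding the square and using `2 ‖∇F‖ ≤ 1 + ‖∇F‖²` for the cross term isolates an error
    -- that tends to zero with `δ n`.
    have hgn2 : ‖fderiv ℝ (fun x => χ n x * Real.exp (F x)) x‖ ^ 2 ≤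
        (χ n x * Real.exp (F x)) ^ 2 * ‖fderiv ℝ F x‖ ^ 2 +
          (δ n + δ n ^ 2) * (Real.exp B ^ 2 * (1 + ‖fderiv ℝ F x‖ ^ 2)) := by
      set a := ‖fderiv ℝ F x‖
      set e := Real.exp (F x)
      have ha : 0 ≤ a := norm_nonneg _
      have h1 : 2 * (χ n x * a) * δ n + δ n ^ 2 ≤ (δ n + δ n ^ 2) * (1 + a ^ 2) := by
        have h2 : 2 * (χ n x * a) ≤ 1 + a ^ 2 := by
          have := mul_le_of_le_one_left ha (hχ1 n x)
          nlinarith [sq_nonneg (a - 1)]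
        have h3 := mul_le_mul_of_nonneg_right h2 (hδ0 n)
        have h4 : 0 ≤ δ n ^ 2 * a ^ 2 := by positivity
        linarith
      calc _ ≤ (e * (χ n x * a + δ n)) ^ 2 := pow_le_pow_left₀ (norm_nonneg _) hgn 2
        _ = (χ n x * e) ^ 2 * a ^ 2 + e ^ 2 * (2 * (χ n x * a) * δ n + δ n ^ 2) := by ring
        _ ≤ (χ n x * e) ^ 2 * a ^ 2 + Real.exp B ^ 2 * ((δ n + δ n ^ 2) * (1 + a ^ 2)) := by
          have := hδ0 n
          have := hχ0 n x
          exact add_le_add le_rfl (mul_le_mul (hexp x) h1 (by positivity) (by positivity))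
        _ = _ := by ring
    have := mul_le_mul_of_nonneg_right hgn2 (hw x)
    linarith
  have hlim : Tendsto (fun n => (∫ x, (χ n x * Real.exp (F x)) ^ 2 *
      ((V x - U x + ‖fderiv ℝ F x‖ ^ 2) * w x)) +
      (δ n + δ n ^ 2) * (Real.exp B ^ 2 * ∫ x, (1 + ‖fderiv ℝ F x‖ ^ 2) * w x)) atTop
      (𝓝 ((∫ x, Real.exp (F x) ^ 2 * ((V x - U x + ‖fderiv ℝ F x‖ ^ 2) * w x)) +
        (0 + 0 ^ 2) * (Real.exp B ^ 2 * ∫ x, (1 + ‖fderiv ℝ F x‖ ^ 2) * w x))) := by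
    refine Tendsto.add ?_ ((hδ.add (hδ.pow 2)).mul_const _)
    refine tendsto_integral_of_dominated_convergence
      (fun x => Real.exp B ^ 2 * ‖(V x - U x + ‖fderiv ℝ F x‖ ^ 2) * w x‖)
      (fun n => (hint n).aestronglyMeasurable) (hk.norm.const_mul _)
      (fun n => .of_forall fun x => ?_) (.of_forall fun x => ?_)
    · rw [norm_mul]
      exact mul_le_mul_of_nonneg_right (hbound n x) (norm_nonneg _)
    · have := (((hχlim x).mul_const (Real.exp (F x))).pow 2).mul_const
        ((V x - U x + ‖fderiv ℝ F x‖ ^ 2) * w x)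
      simpa using this
  have := ge_of_tendsto' hlim hn
  simpa using this

end Agmon

/-! ### Unbounded phases -/

section Fatou

open Filter Topology

/-- Fatou's lemma as an integrability criterion. -/
theorem integrable_of_tendsto_of_integral_le {α : Type*} [MeasurableSpace α] {μ : Measure α}
    {G : ℕ → α → ℝ} {f : α → ℝ} {C : ℝ} (hG : ∀ n, Integrable (G n) μ)
    (hG0 : ∀ n, 0 ≤ᵐ[μ] G n) (hC : ∀ n, ∫ x, G n x ∂μ ≤ C)
    (hlim : ∀ᵐ x ∂μ, Tendsto (fun n => G n x) atTop (𝓝 (f x))) : Integrable f μ := by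
  refine ⟨aestronglyMeasurable_of_tendsto_ae _ (fun n => (hG n).aestronglyMeasurable) hlim, ?_⟩
  have h1 : ∫⁻ x, ‖f x‖ₑ ∂μ ≤ liminf (fun n => ∫⁻ x, ‖G n x‖ₑ ∂μ) atTop :=
    lintegral_congr_ae (by filter_upwards [hlim] with x hx using hx.enorm.liminf_eq) ▸
      lintegral_liminf_le' fun n => (hG n).aestronglyMeasurable.enorm
  have h2 : ∀ n, ∫⁻ x, ‖G n x‖ₑ ∂μ ≤ ENNReal.ofReal C := by
    intro n
    rw [← ofReal_integral_norm_eq_lintegral_enorm (hG n)]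
    refine ENNReal.ofReal_le_ofReal ((le_of_eq ?_).trans (hC n))
    refine integral_congr_ae ?_
    filter_upwards [hG0 n] with x hx using Real.norm_of_nonneg hx
  refine h1.trans_lt (lt_of_le_of_lt ?_ (ENNReal.ofReal_lt_top (r := C)))
  exact liminf_le_of_le (by isBoundedDefault) fun b hb => by
    obtain ⟨n, hn⟩ := hb.exists
    exact hn.trans (h2 n)

end Fatou

section SoftTruncation

open Filter Topology

/-- The function `-log (e^{-F} + ε)`: a smooth version of `min F (-log ε)`, bounded above when
`ε > 0` and equal to `F` when `ε = 0`. -/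
noncomputable def softTruncation {E : Type*} (ε : ℝ) (F : E → ℝ) (x : E) : ℝ :=
  -Real.log (Real.exp (-F x) + ε)

variable {E : Type*}

theorem exp_softTruncation {ε : ℝ} (hε : 0 ≤ ε) (F : E → ℝ) (x : E) :
    Real.exp (softTruncation ε F x) = (Real.exp (-F x) + ε)⁻¹ := by
  have : 0 < Real.exp (-F x) + ε := by positivity
  rw [softTruncation, Real.exp_neg, Real.exp_log this]

theorem softTruncation_le {ε : ℝ} (hε : 0 ≤ ε) (F : E → ℝ) (x : E) :
    softTruncation ε F x ≤ F x := by
  rw [← Real.exp_le_exp, exp_softTruncation hε]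
  rw [show F x = - -F x by ring, Real.exp_neg (-F x), neg_neg]
  exact inv_anti₀ (Real.exp_pos _) (by linarith)

theorem softTruncation_le_neg_log {ε : ℝ} (hε : 0 < ε) (F : E → ℝ) (x : E) :
    softTruncation ε F x ≤ -Real.log ε :=
  neg_le_neg (Real.log_le_log hε (by linarith [Real.exp_pos (-F x)]))

theorem tendsto_exp_softTruncation (F : E → ℝ) (x : E) :
    Tendsto (fun n : ℕ => Real.exp (softTruncation (1 / ((n : ℝ) + 1)) F x)) atTop
      (𝓝 (Real.exp (F x))) := by
  have h : Tendsto (fun n : ℕ => (Real.exp (-F x) + 1 / ((n : ℝ) + 1))⁻¹) atTop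
      (𝓝 (Real.exp (-F x) + 0)⁻¹) :=
    (tendsto_const_nhds.add tendsto_one_div_add_atTop_nhds_zero_nat).inv₀ (by positivity)
  rw [add_zero, ← Real.exp_neg, neg_neg] at h
  exact h.congr fun n => (exp_softTruncation (by positivity) F x).symm

variable [NormedAddCommGroup E] [NormedSpace ℝ E]

theorem contDiff_softTruncation {ε : ℝ} (hε : 0 ≤ ε) {F : E → ℝ} (hF : ContDiff ℝ 1 F) :
    ContDiff ℝ 1 (softTruncation ε F) :=
  ((hF.neg.exp.add contDiff_const).log fun x => by positivity).neg

theorem norm_fderiv_softTruncation_le {ε : ℝ} (hε : 0 ≤ ε) {F : E → ℝ} (hF : ContDiff ℝ 1 F)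
    (x : E) : ‖fderiv ℝ (softTruncation ε F) x‖ ≤ ‖fderiv ℝ F x‖ := by
  have hpos : 0 < Real.exp (-F x) + ε := by positivity
  have h := (((((hF.differentiable one_ne_zero) x).hasFDerivAt.neg.exp).add_const ε).log
    hpos.ne').neg
  rw [show softTruncation ε F = -fun x => Real.log (Real.exp ((-F) x) + ε) from rfl, h.fderiv]
  simp only [Pi.neg_apply, norm_neg, norm_smul, norm_inv, Real.norm_eq_abs, Real.abs_exp,
    abs_of_pos hpos, smul_neg]
  rw [← mul_assoc]
  refine mul_le_of_le_one_left (norm_nonneg _) ?_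
  rw [inv_mul_le_iff₀ hpos]
  linarith

end SoftTruncation

section Agmon

variable {E : Type*} [NormedAddCommGroup E] [InnerProductSpace ℝ E] [FiniteDimensional ℝ E]
  [MeasurableSpace E] [BorelSpace E]

open Filter Topology

/-- Agmon's inequality for an arbitrary `C¹` phase, outside a compact set `K` that carries `V`. On
`K` the phase is bounded, which makes the bounds for its truncations uniform. -/
theorem integrableOn_exp_sq_mul {w V U : E → ℝ} (hw : ∀ x, 0 ≤ w x)
    (hwi : Integrable w) (hVw : Integrable fun x => V x * w x)
    (hUw : Integrable fun x => U x * w x)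
    (henergy : ∀ g : E → ℝ, ContDiff ℝ 1 g → HasCompactSupport g →
      0 ≤ (∫ x, (g x) ^ 2 * ((V x - U x) * w x)) + ∫ x, ‖fderiv ℝ g x‖ ^ 2 * w x)
    {K : Set E} (hK : IsCompact K) (hV0 : ∀ᵐ x, 0 ≤ V x) (hU0 : ∀ᵐ x, 0 ≤ U x)
    (hVK : ∀ᵐ x, x ∉ K → V x = 0)
    {F : E → ℝ} (hF : ContDiff ℝ 1 F) (hFU : ∀ᵐ x, x ∉ K → ‖fderiv ℝ F x‖ ^ 2 ≤ U x) :
    IntegrableOn (fun x => Real.exp (F x) ^ 2 * ((U x - ‖fderiv ℝ F x‖ ^ 2) * w x)) Kᶜ := by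
  have hFc : Continuous F := hF.continuous
  have hdc : Continuous fun x => ‖fderiv ℝ F x‖ ^ 2 :=
    (hF.continuous_fderiv one_ne_zero).norm.pow 2
  have hKm : MeasurableSet K := hK.measurableSet
  have hdFK : IntegrableOn (fun x => ‖fderiv ℝ F x‖ ^ 2 * w x) K :=
    hwi.integrableOn.continuousOn_mul hdc.continuousOn hK
  have hdF : Integrable fun x => ‖fderiv ℝ F x‖ ^ 2 * w x := by
    rw [← integrableOn_univ, ← Set.union_compl_self K]
    refine hdFK.union ?_
    refine (hUw.integrableOn (s := Kᶜ)).mono'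
      (hdc.aestronglyMeasurable.mul hwi.aestronglyMeasurable).restrict ?_
    rw [ae_restrict_iff' hKm.compl]
    filter_upwards [hFU] with x hx hxK
    rw [Real.norm_of_nonneg (mul_nonneg (sq_nonneg _) (hw x))]
    exact mul_le_mul_of_nonneg_right (hx hxK) (hw x)
  have hQ : IntegrableOn
      (fun x => Real.exp (F x) ^ 2 * ((V x + ‖fderiv ℝ F x‖ ^ 2) * w x)) K := by
    refine IntegrableOn.continuousOn_mul (by fun_prop) ?_ hK
    exact ((hVw.add hdF).congr (.of_forall fun x => by
      simp only [Pi.add_apply]; ring)).integrableOn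
  have hP : Integrable fun x => (U x - ‖fderiv ℝ F x‖ ^ 2) * w x :=
    (hUw.sub hdF).congr (.of_forall fun x => by simp only [Pi.sub_apply]; ring)
  set e : ℕ → E → ℝ := fun n => softTruncation (1 / ((n : ℝ) + 1)) F with he
  have hε : ∀ n : ℕ, (0 : ℝ) < 1 / ((n : ℝ) + 1) := fun n => by positivity
  have hec : ∀ n, ContDiff ℝ 1 (e n) := fun n => contDiff_softTruncation (hε n).le hF
  have hbd : ∀ n x, ‖Real.exp (e n x) ^ 2‖ ≤ Real.exp (-Real.log (1 / ((n : ℝ) + 1))) ^ 2 := by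
    intro n x
    rw [Real.norm_of_nonneg (sq_nonneg _)]
    exact pow_le_pow_left₀ (Real.exp_pos _).le
      (Real.exp_le_exp.mpr (softTruncation_le_neg_log (hε n) F x)) 2
  have hem : ∀ n, AEStronglyMeasurable (fun x => Real.exp (e n x) ^ 2) volume := fun n =>
    ((Real.continuous_exp.comp (hec n).continuous).pow 2).aestronglyMeasurable
  have hde : ∀ n x, ‖fderiv ℝ (e n) x‖ ^ 2 ≤ ‖fderiv ℝ F x‖ ^ 2 := fun n x =>
    pow_le_pow_left₀ (norm_nonneg _) (norm_fderiv_softTruncation_le (hε n).le hF x) 2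
  have hdei : ∀ n, Integrable fun x => ‖fderiv ℝ (e n) x‖ ^ 2 * w x := by
    intro n
    refine hdF.mono' ((((hec n).continuous_fderiv one_ne_zero).norm.pow 2).aestronglyMeasurable.mul
      hwi.aestronglyMeasurable) (.of_forall fun x => ?_)
    rw [Real.norm_of_nonneg (mul_nonneg (sq_nonneg _) (hw x))]
    exact mul_le_mul_of_nonneg_right (hde n x) (hw x)
  have hPn : ∀ n, Integrable fun x =>
      Real.exp (e n x) ^ 2 * ((U x - ‖fderiv ℝ F x‖ ^ 2) * w x) := fun n =>
    hP.bdd_mul (hem n) (.of_forall (hbd n))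
  refine integrable_of_tendsto_of_integral_le
    (G := fun n x => Real.exp (e n x) ^ 2 * ((U x - ‖fderiv ℝ F x‖ ^ 2) * w x))
    (C := ∫ x in K, Real.exp (F x) ^ 2 * ((V x + ‖fderiv ℝ F x‖ ^ 2) * w x))
    (fun n => (hPn n).integrableOn) (fun n => ?_) (fun n => ?_) (.of_forall fun x => ?_)
  · rw [Filter.EventuallyLE, ae_restrict_iff' hKm.compl]
    filter_upwards [hFU] with x hx hxK
    exact mul_nonneg (sq_nonneg _) (mul_nonneg (sub_nonneg.mpr (hx hxK)) (hw x))
  · have h0 := integral_exp_sq_mul_nonneg_of_bddAbove hw hwi hVw hUw henergy (hec n)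
      (softTruncation_le_neg_log (hε n) F) (hdei n)
    have hi : Integrable fun x =>
        Real.exp (e n x) ^ 2 * ((V x - U x + ‖fderiv ℝ (e n) x‖ ^ 2) * w x) := by
      refine Integrable.bdd_mul ?_ (hem n) (.of_forall (hbd n))
      exact ((hVw.sub hUw).add (hdei n)).congr (.of_forall fun x => by
        simp only [Pi.add_apply, Pi.sub_apply]; ring)
    rw [← integral_add_compl hKm hi] at h0
    have h1 : (∫ x in K, Real.exp (e n x) ^ 2 * ((V x - U x + ‖fderiv ℝ (e n) x‖ ^ 2) * w x)) ≤
        ∫ x in K, Real.exp (F x) ^ 2 * ((V x + ‖fderiv ℝ F x‖ ^ 2) * w x) := by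
      refine setIntegral_mono_ae hi.integrableOn hQ ?_
      filter_upwards [hU0, hV0] with x hUx hVx
      have hexp : Real.exp (e n x) ^ 2 ≤ Real.exp (F x) ^ 2 := pow_le_pow_left₀ (Real.exp_pos _).le
        (Real.exp_le_exp.mpr (softTruncation_le (hε n).le F x)) 2
      calc _ ≤ Real.exp (e n x) ^ 2 * ((V x + ‖fderiv ℝ F x‖ ^ 2) * w x) := by
            refine mul_le_mul_of_nonneg_left (mul_le_mul_of_nonneg_right ?_ (hw x)) (sq_nonneg _)
            linarith [hde n x]
        _ ≤ _ := mul_le_mul_of_nonneg_right hexp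
            (mul_nonneg (add_nonneg hVx (sq_nonneg _)) (hw x))
    have h2 : (∫ x in Kᶜ, Real.exp (e n x) ^ 2 * ((V x - U x + ‖fderiv ℝ (e n) x‖ ^ 2) * w x)) ≤
        ∫ x in Kᶜ, -(Real.exp (e n x) ^ 2 * ((U x - ‖fderiv ℝ F x‖ ^ 2) * w x)) := by
      refine setIntegral_mono_on_ae hi.integrableOn (hPn n).neg.integrableOn hKm.compl ?_
      filter_upwards [hVK] with x hx hxK
      rw [hx hxK, ← mul_neg, ← neg_mul]
      refine mul_le_mul_of_nonneg_left (mul_le_mul_of_nonneg_right ?_ (hw x)) (sq_nonneg _)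
      linarith [hde n x]
    rw [integral_neg] at h2
    linarith
  · exact ((tendsto_exp_softTruncation F x).pow 2).mul_const _

/-- Off `K` the squared modulus of the weighted function is `e^{2F} (U - ‖∇F‖²) |f|²`. On `K` it is
dominated by a constant multiple of `(U + ‖∇F‖² + 1) |f|²`; the summand `1` accounts for the zeros
of `U - ‖∇F‖²`, where `Real.log` is `0`. -/
theorem memLp_exp_mul_of_integrableOn {w U : E → ℝ} {f : E → ℂ} (hf : AEStronglyMeasurable f)
    (hfw : ∀ x, w x = ‖f x‖ ^ 2) (hUm : AEMeasurable U volume) (hwi : Integrable w)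
    (hUw : Integrable fun x => U x * w x) (hU0 : ∀ᵐ x, 0 ≤ U x) {K : Set E} (hK : IsCompact K)
    {F : E → ℝ} (hF : ContDiff ℝ 1 F) (hFU : ∀ᵐ x, x ∉ K → ‖fderiv ℝ F x‖ ^ 2 < U x)
    (h : IntegrableOn (fun x => Real.exp (F x) ^ 2 * ((U x - ‖fderiv ℝ F x‖ ^ 2) * w x)) Kᶜ) :
    MemLp (fun x => ((Real.exp (F x + 1 / 2 * Real.log (U x - ‖fderiv ℝ F x‖ ^ 2)) : ℝ) : ℂ) * f x)
      2 volume := by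
  have hFc : Continuous F := hF.continuous
  have hdc : Continuous fun x => ‖fderiv ℝ F x‖ ^ 2 :=
    (hF.continuous_fderiv one_ne_zero).norm.pow 2
  have hKm : MeasurableSet K := hK.measurableSet
  have hm : AEMeasurable (fun x =>
      Real.exp (F x + 1 / 2 * Real.log (U x - ‖fderiv ℝ F x‖ ^ 2))) volume :=
    (hFc.aemeasurable.add
      ((hUm.sub hdc.aemeasurable).log.const_mul _)).exp
  have hm' : AEStronglyMeasurable (fun x =>
      ((Real.exp (F x + 1 / 2 * Real.log (U x - ‖fderiv ℝ F x‖ ^ 2)) : ℝ) : ℂ) * f x) volume :=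
    (Complex.measurable_ofReal.comp_aemeasurable hm).aestronglyMeasurable.mul hf
  rw [memLp_two_iff_integrable_sq_norm hm']
  have hsq : ∀ x, ‖((Real.exp (F x + 1 / 2 * Real.log (U x - ‖fderiv ℝ F x‖ ^ 2)) : ℝ) : ℂ) *
      f x‖ ^ 2 = Real.exp (F x) ^ 2 * (Real.exp (Real.log (U x - ‖fderiv ℝ F x‖ ^ 2)) * w x) := by
    intro x
    rw [norm_mul, Complex.norm_real, Real.norm_of_nonneg (Real.exp_pos _).le, mul_pow, ← hfw,
      ← mul_assoc]
    congr 1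
    rw [← Real.exp_nat_mul, ← Real.exp_nat_mul, ← Real.exp_add]
    congr 1
    push_cast
    ring
  have hmsq : AEStronglyMeasurable (fun x => Real.exp (F x) ^ 2 *
      (Real.exp (Real.log (U x - ‖fderiv ℝ F x‖ ^ 2)) * w x)) volume :=
    (hm'.norm.pow 2).congr (.of_forall hsq)
  simp only [hsq]
  rw [← integrableOn_univ, ← Set.union_compl_self K]
  refine IntegrableOn.union ?_ ?_
  · have hdom : IntegrableOn
        (fun x => Real.exp (F x) ^ 2 * ((U x + ‖fderiv ℝ F x‖ ^ 2 + 1) * w x)) K := by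
      refine IntegrableOn.continuousOn_mul (by fun_prop) ?_ hK
      have h1 : IntegrableOn (fun x => ‖fderiv ℝ F x‖ ^ 2 * w x) K :=
        hwi.integrableOn.continuousOn_mul hdc.continuousOn hK
      exact ((hUw.integrableOn.add h1).add hwi.integrableOn).congr (.of_forall fun x => by
        simp only [Pi.add_apply]; ring)
    refine hdom.mono' hmsq.restrict (ae_restrict_of_ae ?_)
    filter_upwards [hU0] with x hx
    have hwx : 0 ≤ w x := by rw [hfw]; positivity
    rw [Real.norm_of_nonneg (by positivity)]
    refine mul_le_mul_of_nonneg_left (mul_le_mul_of_nonneg_right ?_ hwx) (sq_nonneg _)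
    rcases eq_or_ne (U x - ‖fderiv ℝ F x‖ ^ 2) 0 with h0 | h0
    · rw [h0, Real.log_zero, Real.exp_zero]
      exact le_add_of_nonneg_left (by positivity)
    · rw [Real.exp_log_eq_abs h0]
      have : 0 ≤ ‖fderiv ℝ F x‖ ^ 2 := sq_nonneg _
      exact abs_le.mpr ⟨by linarith, by linarith⟩
  · refine h.congr ?_
    rw [Filter.EventuallyEq, ae_restrict_iff' hKm.compl]
    filter_upwards [hFU] with x hx hxK
    rw [Real.exp_log (sub_pos.mpr (hx hxK))]

end Agmon

/-! ### The phase `K (1 + |x|²)^{1/4}` and the Schrödinger operator -/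

section Radial

variable {E : Type*} [NormedAddCommGroup E]

/-- The phase `K (1 + ‖x‖²)^{1/4}`, a function differentiable at the origin that behaves like
`K √‖x‖` at infinity. Iterated square roots stand for the fourth root. -/
noncomputable def sqrtPhase (K : ℝ) (x : E) : ℝ := K * √√(1 + ‖x‖ ^ 2)

theorem mul_sqrt_norm_le_sqrtPhase {K : ℝ} (hK : 0 ≤ K) (x : E) :
    K * √‖x‖ ≤ sqrtPhase K x :=
  mul_le_mul_of_nonneg_left (Real.sqrt_le_sqrt (Real.le_sqrt_of_sq_le (by linarith))) hK

variable [InnerProductSpace ℝ E]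

theorem norm_gradient_eq [CompleteSpace E] (F : E → ℝ) (x : E) : ‖∇ F x‖ = ‖fderiv ℝ F x‖ :=
  LinearIsometryEquiv.norm_map _ _

theorem contDiff_sqrtPhase (K : ℝ) : ContDiff ℝ 1 (sqrtPhase K : E → ℝ) :=
  contDiff_const.mul (((contDiff_const.add (contDiff_norm_sq ℝ)).sqrt
    fun x => by positivity).sqrt fun x => by positivity)

theorem norm_fderiv_sqrtPhase_sq_le (K : ℝ) {x : E} (hx : x ≠ 0) :
    ‖fderiv ℝ (sqrtPhase K) x‖ ^ 2 ≤ K ^ 2 / 4 / ‖x‖ := by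
  have hr : 0 < ‖x‖ := norm_pos_iff.mpr hx
  set s := √(1 + ‖x‖ ^ 2) with hs
  have hs0 : 0 < s := by positivity
  have hss : s ^ 2 = 1 + ‖x‖ ^ 2 := Real.sq_sqrt (by positivity)
  have hrs : ‖x‖ ≤ s := Real.le_sqrt_of_sq_le (by linarith)
  have hq : (√s) ^ 2 = s := Real.sq_sqrt hs0.le
  have h1 : HasFDerivAt (fun y : E => 1 + ‖y‖ ^ 2) (2 • innerSL ℝ x) x := by
    simpa using (hasStrictFDerivAt_norm_sq x).hasFDerivAt.const_add 1
  have h2 := ((h1.sqrt (by positivity)).sqrt hs0.ne').const_mul K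
  have h3 : ‖fderiv ℝ (sqrtPhase K) x‖ ≤ |K| * (‖x‖ / (2 * √s * s)) := by
    rw [show (sqrtPhase K : E → ℝ) = fun y => K * √√(1 + ‖y‖ ^ 2) from rfl, h2.fderiv]
    rw [← hs, show K • (1 / (2 * √s)) • (1 / (2 * s)) • 2 • innerSL ℝ x =
      (K * (1 / (2 * √s * s))) • innerSL ℝ x by module]
    rw [norm_smul, norm_mul, innerSL_apply_norm, Real.norm_eq_abs,
      Real.norm_of_nonneg (by positivity)]
    exact le_of_eq (by ring)
  calc _ ≤ (|K| * (‖x‖ / (2 * √s * s))) ^ 2 := pow_le_pow_left₀ (norm_nonneg _) h3 2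
    _ = K ^ 2 / 4 * (‖x‖ ^ 2 / (s * s ^ 2)) := by
      rw [mul_pow, sq_abs, div_pow, mul_pow, mul_pow, hq]
      ring
    _ ≤ K ^ 2 / 4 * (1 / ‖x‖) := by
      refine mul_le_mul_of_nonneg_left ?_ (by positivity)
      rw [div_le_div_iff₀ (by positivity) hr]
      calc ‖x‖ ^ 2 * ‖x‖ = ‖x‖ ^ 3 := by ring
        _ ≤ s ^ 3 := pow_le_pow_left₀ hr.le hrs 3
        _ = _ := by ring
    _ = _ := by ring

end Radial

/-- Membership in the operator domain of `W` gives the form bound, since `W |f|² = |W f| |f|`. -/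
theorem integrable_mul_sq_norm_of_mem_mulDomain {W : R3 → ℝ} (hW : ∀ᵐ x, 0 ≤ W x) {f : L2R3}
    (hf : f ∈ mulDomain W) : Integrable fun x => W x * ‖f x‖ ^ 2 := by
  refine ((mem_mulDomain hf).integrable_mul (Lp.memLp f)).norm.congr ?_
  filter_upwards [hW] with x hx
  simp only [Pi.mul_apply, norm_mul, Complex.norm_real, Real.norm_of_nonneg hx]
  ring

theorem mulOp_apply_ae (W : R3 → ℝ) (f : (mulOp W).domain) :
    (mulOp W f : R3 → ℂ) =ᵐ[volume] fun x => (W x : ℂ) * (f : L2R3) x :=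
  (mem_mulDomain f.2).coeFn_toLp

/-- The localized energy inequality for a zero-energy state, where `-Δψ = (V - U)ψ`. -/
theorem hamiltonian_energy_nonneg {V U : R3 → ℝ} (ψ : (hamiltonian V U).domain)
    (hψ : hamiltonian V U ψ = 0) {g : R3 → ℝ} (hg : ContDiff ℝ 1 g) (hgs : HasCompactSupport g) :
    0 ≤ (∫ x, (g x) ^ 2 * ((V x - U x) * ‖(ψ : L2R3) x‖ ^ 2)) +
      ∫ x, ‖fderiv ℝ g x‖ ^ 2 * ‖(ψ : L2R3) x‖ ^ 2 := by
  have hd : ((ψ : L2R3) ∈ sobolevH2 ∧ (ψ : L2R3) ∈ mulDomain V) ∧ (ψ : L2R3) ∈ mulDomain U := ψ.2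
  let ψA : negLaplacian.domain := ⟨ψ, hd.1.1⟩
  let ψV : (mulOp V).domain := ⟨ψ, hd.1.2⟩
  let ψU : (mulOp U).domain := ⟨ψ, hd.2⟩
  have h0 : negLaplacian ψA - mulOp V ψV + mulOp U ψU = 0 := hψ
  have hA : negLaplacian ψA = mulOp V ψV - mulOp U ψU := by
    rw [← sub_eq_zero, ← h0]
    abel
  have h := localized_energy_nonneg (f := (ψ : L2R3)) hd.1.1 (negLaplacian_spec ψA) hg hgs
  have e : (∫ x, (g x) ^ 2 * inner ℝ ((ψ : L2R3) x) ((negLaplacian ψA : L2R3) x)) =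
      ∫ x, (g x) ^ 2 * ((V x - U x) * ‖(ψ : L2R3) x‖ ^ 2) := by
    refine integral_congr_ae ?_
    rw [hA]
    filter_upwards [Lp.coeFn_sub (mulOp V ψV) (mulOp U ψU), mulOp_apply_ae V ψV,
      mulOp_apply_ae U ψU] with x h1 h2 h3
    have h4 : ((mulOp V ψV - mulOp U ψU : L2R3) : R3 → ℂ) x = (V x - U x) • (ψ : L2R3) x := by
      rw [h1, Pi.sub_apply, h2, h3, Complex.real_smul, Complex.ofReal_sub, sub_mul]
    rw [h4, real_inner_smul_right, real_inner_self_eq_norm_sq]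
  rwa [e] at h

theorem theorem2p1 (R : ℝ) (hR : 0 < R) (V U : R3 → ℝ)
    (hVm : AEMeasurable V volume) (hUm : AEMeasurable U volume)
    (hV : ∀ᵐ x : R3, 0 ≤ V x) (hVsupp : ∀ᵐ x : R3, R < ‖x‖ → V x = 0)
    (hU : ∀ᵐ x : R3, 0 < U x) (hUbdd : InfinitesimallyBounded (mulOp U) negLaplacian)
    (ψ : (hamiltonian V U).domain) (hψ : ‖(ψ : L2R3)‖ = 1) (hHψ : hamiltonian V U ψ = 0) :
    (∀ F : R3 → ℝ, ContDiff ℝ 1 F → (∀ᵐ x : R3, R < ‖x‖ → ‖∇ F x‖ ^ 2 < U x) →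
      MemLp (fun x : R3 =>
        ((Real.exp (F x + 1 / 2 * Real.log (U x - ‖∇ F x‖ ^ 2)) : ℝ) : ℂ) * (ψ : L2R3) x)
        2 volume) ∧
    (∀ C : ℝ, 0 < C → (∀ᵐ x : R3, R < ‖x‖ → U x = C / ‖x‖) → ∀ K : ℝ, K < 2 * √C →
      MemLp (fun x : R3 => ((Real.exp (K * √‖x‖) : ℝ) : ℂ) * (ψ : L2R3) x) 2 volume) := by
  have hd : ((ψ : L2R3) ∈ sobolevH2 ∧ (ψ : L2R3) ∈ mulDomain V) ∧ (ψ : L2R3) ∈ mulDomain U := ψ.2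
  have hU0 : ∀ᵐ x : R3, 0 ≤ U x := hU.mono fun x hx => hx.le
  have hψm : MemLp (ψ : L2R3) 2 volume := Lp.memLp (ψ : L2R3)
  have hout : ∀ x : R3, x ∉ Metric.closedBall (0 : R3) R ↔ R < ‖x‖ := fun x => by
    rw [mem_closedBall_zero_iff, not_le]
  have hw : Integrable fun x => ‖(ψ : L2R3) x‖ ^ 2 :=
    (memLp_two_iff_integrable_sq_norm hψm.1).mp hψm
  have hVw := integrable_mul_sq_norm_of_mem_mulDomain hV hd.1.2
  have hUw := integrable_mul_sq_norm_of_mem_mulDomain hU0 hd.2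
  have part1 : ∀ F : R3 → ℝ, ContDiff ℝ 1 F → (∀ᵐ x : R3, R < ‖x‖ → ‖∇ F x‖ ^ 2 < U x) →
      MemLp (fun x : R3 =>
        ((Real.exp (F x + 1 / 2 * Real.log (U x - ‖∇ F x‖ ^ 2)) : ℝ) : ℂ) * (ψ : L2R3) x)
        2 volume := by
    intro F hF hFU
    simp only [norm_gradient_eq, ← hout] at hFU hVsupp ⊢
    refine memLp_exp_mul_of_integrableOn hψm.1 (fun x => rfl) hUm hw hUw hU0
      (isCompact_closedBall 0 R) hF hFU ?_
    exact integrableOn_exp_sq_mul (fun x => sq_nonneg _) hw hVw hUw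
      (fun g hg hgs => hamiltonian_energy_nonneg ψ hHψ hg hgs) (isCompact_closedBall 0 R) hV hU0
      hVsupp hF (hFU.mono fun x hx hxK => (hx hxK).le)
  refine ⟨part1, fun C hC hUC K hK => ?_⟩
  -- The maximum with `0` makes `K'` positive even when `K` is not.
  obtain ⟨K', hKK', hK'C⟩ := exists_between (max_lt hK (by positivity : 0 < 2 * √C))
  have hK'0 : 0 < K' := (le_max_right _ _).trans_lt hKK'
  have hd0 : 0 < K' - K := sub_pos.mpr ((le_max_left _ _).trans_lt hKK')
  have hc : 0 < C - K' ^ 2 / 4 := by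
    have : K' ^ 2 < (2 * √C) ^ 2 := by gcongr
    rw [mul_pow, Real.sq_sqrt hC.le] at this
    linarith
  set c := C - K' ^ 2 / 4 with hcdef
  have hgap : ∀ᵐ x : R3, R < ‖x‖ → c / ‖x‖ ≤ U x - ‖∇ (sqrtPhase K') x‖ ^ 2 := by
    filter_upwards [hUC] with x hx hxR
    have hx0 : x ≠ 0 := norm_pos_iff.mp (hR.trans hxR)
    rw [hx hxR, norm_gradient_eq, hcdef, sub_div]
    linarith [norm_fderiv_sqrtPhase_sq_le K' hx0]
  have hP := part1 (sqrtPhase K') (contDiff_sqrtPhase K') <| hgap.mono fun x hx hxR => by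
    have : 0 < c / ‖x‖ := div_pos hc (hR.trans hxR)
    linarith [hx hxR]
  have hdom := (hψm.norm.const_mul (Real.exp (|K| * √R))).add
    (hP.norm.const_mul (1 / ((K' - K) * √c)))
  have hm : AEStronglyMeasurable
      (fun x : R3 => ((Real.exp (K * √‖x‖) : ℝ) : ℂ) * (ψ : L2R3) x) volume :=
    (Continuous.aestronglyMeasurable (by fun_prop)).mul hψm.1
  refine hdom.mono hm ?_
  filter_upwards [hgap] with x hx
  refine le_trans ?_ (le_abs_self _)
  simp only [Pi.add_apply, norm_mul, Complex.norm_real, Real.norm_of_nonneg (Real.exp_pos _).le]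
  have hψx : 0 ≤ ‖(ψ : L2R3) x‖ := norm_nonneg _
  rcases le_or_gt ‖x‖ R with hxR | hxR
  · refine le_add_of_le_of_nonneg (mul_le_mul_of_nonneg_right (Real.exp_le_exp.mpr ?_) hψx)
      (by positivity)
    calc K * √‖x‖ ≤ |K| * √‖x‖ := mul_le_mul_of_nonneg_right (le_abs_self K) (Real.sqrt_nonneg _)
      _ ≤ |K| * √R := mul_le_mul_of_nonneg_left (Real.sqrt_le_sqrt hxR) (abs_nonneg K)
  · refine le_add_of_nonneg_of_le (by positivity) ?_
    rw [← mul_assoc]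
    refine mul_le_mul_of_nonneg_right ?_ hψx
    have hr : 0 < ‖x‖ := hR.trans hxR
    have hsr : 0 < √‖x‖ := Real.sqrt_pos.mpr hr
    have hsc : 0 < √c := Real.sqrt_pos.mpr hc
    have hexp : √c / √‖x‖ ≤ Real.exp (1 / 2 * Real.log (U x - ‖∇ (sqrtPhase K') x‖ ^ 2)) := by
      have hpos : 0 < c / ‖x‖ := div_pos hc hr
      rw [← Real.sqrt_div hc.le, mul_comm, ← Real.rpow_def_of_pos (hpos.trans_le (hx hxR)),
        ← Real.sqrt_eq_rpow]
      exact Real.sqrt_le_sqrt (hx hxR)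
    -- This bound turns the spare exponential `e^{(K' - K) √‖x‖}` into the missing factor `√‖x‖`.
    have hlin : (K' - K) * √‖x‖ ≤ Real.exp ((K' - K) * √‖x‖) := by
      linarith [Real.add_one_le_exp ((K' - K) * √‖x‖)]
    rw [Real.exp_add]
    calc Real.exp (K * √‖x‖)
        = 1 / ((K' - K) * √c) * (Real.exp (K * √‖x‖) * ((K' - K) * √‖x‖) * (√c / √‖x‖)) := by
          field_simp
      _ ≤ 1 / ((K' - K) * √c) * (Real.exp (K * √‖x‖) * Real.exp ((K' - K) * √‖x‖) *
            Real.exp (1 / 2 * Real.log (U x - ‖∇ (sqrtPhase K') x‖ ^ 2))) := by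
          gcongr
      _ ≤ 1 / ((K' - K) * √c) * (Real.exp (sqrtPhase K' x) *
            Real.exp (1 / 2 * Real.log (U x - ‖∇ (sqrtPhase K') x‖ ^ 2))) := by
          rw [← Real.exp_add]
          gcongr
          calc K * √‖x‖ + (K' - K) * √‖x‖ = K' * √‖x‖ := by ring
            _ ≤ _ := mul_sqrt_norm_le_sqrtPhase hK'0.le x
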